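/- Let $a>b>0$ and $p=\sqrt{a^2+b^2}$. In $\mathbb R^9$ with coordinates $(\omega,\alpha,\beta)$, $\omega,\alpha,\beta\in\mathbb R^3$, let $$P^6=\{|\alpha|=a,\ |\beta|=b,\ \alpha\cdot\beta=0\},\qquad \gamma=\alpha\times\beta,$$ and let $J=(H,K,G):P^6\to\mathbb R^3(h,k,g)$ be the map of first integrals of the generalized Kowalevski top in a double force field, $$H=\omega_1^2+\omega_2^2+\tfrac12\omega_3^2-(\alpha_1+\beta_2),$$ $$K=(\omega_1^2-\omega_2^2+\alpha_1-\beta_2)^2+(2\omega_1\omega_2+\alpha_2+\beta_1)^2,$$ $$G=(\alpha_1\omega_1+\alpha_2\omega_2+\tfrac12\alpha_3\omega_3)^2+(\beta_1\omega_1+\beta_2\omega_2+\tfrac12\beta_3\omega_3)^2+\omega_3(\gamma_1\omega_1+\gamma_2\omega_2+\tfrac12\gamma_3\omega_3)-\alpha_1b^2-\beta_2a^2 .$$ Let $\Sigma$ be the bifurcation diagram of $J$, that is, the image under $J$ of the set of points of $P^6$ at which $J$ has rank less than $3$, and let $\Sigma_1=\{(h,k,g):k=0\}$. Put $\phi(s)=\sqrt{(s^2-a^2)(s^2-b^2)/s^2}$.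 The function $s\mapsto 2s+\phi(s)$ is strictly increasing on $[-b,0)$ and maps $[-b,0)$ bijectively onto $[-2b,+\infty)$; let $s_1:[-2b,+\infty)\to[-b,0)$ be its inverse, and for $h\ge-2b$ put $$g_1(h)=\Bigl(s^3+\frac{a^2b^2}{s}+s^2\phi(s)\Bigr)\Big|_{s=s_1(h)} .$$ Then $$\Sigma_1\cap\Sigma=\Bigl\{(h,k,g)\in\mathbb R^3:\ k=0,\ h\ge-2b,\ g_1(h)\le g\le\tfrac12p^2h\Bigr\}.$$ -/

import Mathlib

noncomputable section

namespace KowalevskiTop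

/-- The space `ℝ⁹` of triples `ζ = (ω, α, β)`: the angular velocity and the two characteristic
vectors of the force fields, in the moving axes (the indices `0, 1, 2` stand for `1, 2, 3`). -/
abbrev Config : Type := (Fin 3 → ℝ) × (Fin 3 → ℝ) × (Fin 3 → ℝ)

/-- The geometric integrals `(|α|², |β|², α · β)`. -/
def geom (ζ : Config) : ℝ × ℝ × ℝ :=
  (ζ.2.1 0 ^ 2 + ζ.2.1 1 ^ 2 + ζ.2.1 2 ^ 2,
   ζ.2.2 0 ^ 2 + ζ.2.2 1 ^ 2 + ζ.2.2 2 ^ 2,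
   ζ.2.1 0 * ζ.2.2 0 + ζ.2.1 1 * ζ.2.2 1 + ζ.2.1 2 * ζ.2.2 2)

/-- The phase space `P⁶`, given by `|α| = a`, `|β| = b`, `α ⊥ β`. -/
def phaseSpace (a b : ℝ) : Set Config := {ζ | geom ζ = (a ^ 2, b ^ 2, 0)}

/-- The energy integral `H`. -/
def intH (ζ : Config) : ℝ :=
  ζ.1 0 ^ 2 + ζ.1 1 ^ 2 + 1 / 2 * ζ.1 2 ^ 2 - (ζ.2.1 0 + ζ.2.2 1)

/-- The integral `K`. -/
def intK (ζ : Config) : ℝ :=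
  (ζ.1 0 ^ 2 - ζ.1 1 ^ 2 + ζ.2.1 0 - ζ.2.2 1) ^ 2
    + (2 * ζ.1 0 * ζ.1 1 + ζ.2.1 1 + ζ.2.2 0) ^ 2

/-- The vector `γ = α × β`. -/
def gam (ζ : Config) : Fin 3 → ℝ := crossProduct ζ.2.1 ζ.2.2

/-- The integral `G` (it contains the field intensities `a`, `b`). -/
def intG (a b : ℝ) (ζ : Config) : ℝ :=
  (ζ.2.1 0 * ζ.1 0 + ζ.2.1 1 * ζ.1 1 + 1 / 2 * ζ.2.1 2 * ζ.1 2) ^ 2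
    + (ζ.2.2 0 * ζ.1 0 + ζ.2.2 1 * ζ.1 1 + 1 / 2 * ζ.2.2 2 * ζ.1 2) ^ 2
    + ζ.1 2 * (gam ζ 0 * ζ.1 0 + gam ζ 1 * ζ.1 1 + 1 / 2 * gam ζ 2 * ζ.1 2)
    - ζ.2.1 0 * b ^ 2 - ζ.2.2 1 * a ^ 2

/-- The integral map `J = H × K × G`, as a map on all of `ℝ⁹`; its values are `(h, k, g)`. -/
def J (a b : ℝ) (ζ : Config) : ℝ × ℝ × ℝ := (intH ζ, intK ζ, intG a b ζ)

/-- The tangent space of `P⁶` at `ζ`, as a subspace of `ℝ⁹`. For `a, b ≠ 0` the phase space is a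
regular level set of `geom`, so that this is the kernel of the differential of `geom`. -/
def tangent (ζ : Config) : Submodule ℝ Config :=
  LinearMap.ker (fderiv ℝ geom ζ : Config →ₗ[ℝ] ℝ × ℝ × ℝ)

/-- The rank at `ζ` of the integral map `J` restricted to `P⁶`: the dimension of the image of the
tangent space of `P⁶` under the differential of `J`. -/
def rankJ (a b : ℝ) (ζ : Config) : ℕ :=
  Module.finrank ℝ ((tangent ζ).map (fderiv ℝ (J a b) ζ : Config →ₗ[ℝ] ℝ × ℝ × ℝ))

/-- The set `c(J)` of critical points of `J : P⁶ → ℝ³`. -/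
def critJ (a b : ℝ) : Set Config := {ζ | ζ ∈ phaseSpace a b ∧ rankJ a b ζ < 3}

/-- The bifurcation diagram `Σ = Σ(J)`: the set of critical values `(h, k, g)` of `J`. -/
def bifDiagram (a b : ℝ) : Set (ℝ × ℝ × ℝ) := J a b '' critJ a b

/-- The surface `Σ₁ = {k = 0}` in the space `ℝ³(h, k, g)`. -/
def sigma1 : Set (ℝ × ℝ × ℝ) := {x | x.2.1 = 0}

/-- The parameter `p`, with `p² = a² + b²`. -/
def p (a b : ℝ) : ℝ := Real.sqrt (a ^ 2 + b ^ 2)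

/-- The function `φ(s) = √((s² - a²)(s² - b²) / s²)`. -/
def phi (a b s : ℝ) : ℝ := Real.sqrt ((s ^ 2 - a ^ 2) * (s ^ 2 - b ^ 2) / s ^ 2)

/-- The energy along the curve `δ₁`: `h = 2s + φ(s)`, where `s` runs through `[-b, 0)`. -/
def delta1 (a b s : ℝ) : ℝ := 2 * s + phi a b s

/-- The inverse `s₁(h) ∈ [-b, 0)`, `h ≥ -2b`, of the dependence of `h` on `s` along `δ₁`. -/
def s1 (a b : ℝ) : ℝ → ℝ := Function.invFunOn (delta1 a b) (Set.Ico (-b) 0)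

/-- The value of `g` along `δ₁` as a function of `h`: `g₁(h) = s³ + a²b²/s + s²φ(s)` at
`s = s₁(h)`, that is `g = s²(h - s) + a²b²/s` with `h = 2s + φ(s)`. -/
def g1 (a b h : ℝ) : ℝ :=
  s1 a b h ^ 3 + (a * b) ^ 2 / s1 a b h + s1 a b h ^ 2 * phi a b (s1 a b h)

end KowalevskiTop

end

/-!
# The level `k = 0` of the bifurcation diagram

The integral `K` is a sum of two squares, so each point of `P⁶` with `K = 0` minimizes `K`; the
differential of `K` vanishes there and the point is critical. Hence `Σ₁ ∩ Σ` is the image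
of the four-dimensional set `{K = 0} ⊆ P⁶` under `(H, G)`, and the theorem describes that image.

On `{K = 0}` one has `G = p² H / 2 - F² / 4` with
`F = (ω₁² + ω₂²) ω₃ + 2 (α₃ ω₁ + β₃ ω₂)` (`intG_eq_of_intK_eq_zero`), so the range of `|F|` on each
level `H = h` has to be found. Parametrize `h = -2σ + A B / σ` by `σ = -s ∈ (0, b]`,
where `A = √(a² - σ²)` and `B = √(b² - σ²)`, so that `φ(s) = A B / σ`. In these terms
`g₁(h) = p² h / 2 - φ (A + B)² / 2` (`g1_delta1_eq`), and the claim is that `|F|` takes exactly the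
values of the interval from `0` to `√(2 φ) (A + B)`.

* Upper bound. The greatest value of `F` on the level `H = h` turns out to be a concave function of
  `h`, with slope `1 / θ`, `θ² = 2 φ / (A + B)²`. It is therefore enough to bound the function
  `H - θ F` below. With Lagrange multipliers for `|α|²`, `|β|²`, it is a constant plus a
  sum of squares (`intH_sub_partialF_eq`). For `σ = b` the same identity shows `H ≥ -2b`, with
  `F = 0` in the case of equality.
* Attainment. The points with `β = (0, b, 0)`, `ω₂ = 0`, `α₁ = b - ω₁²` and `α₂ = 0` satisfy
  `K = 0`. On a fixed level of `H` they form a curve with parameter `u = ω₁²`, along which `F` varies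
  continuously from `0` at `u = 0` to the upper bound at `u = (A + B) √((b - σ) / (b + σ))`.
-/

namespace KowalevskiTop

/-! ### The energy along the curve `δ₁` -/

/-- On `[-b, 0)` the radicand of `φ` is a product of nonnegative factors. -/
lemma phi_eq {a b s : ℝ} (hab : b < a) (hs : s ∈ Set.Ico (-b) 0) :
    phi a b s = √(a ^ 2 - s ^ 2) * √(b ^ 2 - s ^ 2) / (-s) := by
  obtain ⟨h1, h2⟩ := hs
  have ha : 0 ≤ a ^ 2 - s ^ 2 := by nlinarith
  have h3 : (s ^ 2 - a ^ 2) * (s ^ 2 - b ^ 2) / s ^ 2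
      = (a ^ 2 - s ^ 2) * (b ^ 2 - s ^ 2) / (-s) ^ 2 := by
    rw [neg_sq]; ring
  rw [phi, h3, Real.sqrt_div' _ (sq_nonneg _), Real.sqrt_mul ha, Real.sqrt_sq (by linarith)]

lemma phi_le_phi {a b s t : ℝ} (hab : b < a) (hs : -b ≤ s) (hst : s < t) (ht : t < 0) :
    phi a b s ≤ phi a b t := by
  have h1 : t ^ 2 ≤ s ^ 2 := by nlinarith
  have h2 : s ^ 2 ≤ b ^ 2 := by nlinarith
  have h3 : s ^ 2 ≤ a ^ 2 := by nlinarith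
  have h4 : 0 < t ^ 2 := by nlinarith
  refine Real.sqrt_le_sqrt (div_le_div₀ ?_ ?_ h4 h1)
  · exact mul_nonneg_of_nonpos_of_nonpos (by linarith) (by linarith)
  · nlinarith [mul_nonneg (sub_nonneg.2 h3) (sub_nonneg.2 h1),
      mul_nonneg (sub_nonneg.2 h2) (sub_nonneg.2 h1),
      mul_nonneg (sub_nonneg.2 (h1.trans h3)) (sub_nonneg.2 h1)]

lemma strictMonoOn_delta1 {a b : ℝ} (hab : b < a) :
    StrictMonoOn (delta1 a b) (Set.Ico (-b) 0) := by
  intro s hs t ht hst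
  have := phi_le_phi hab hs.1 hst ht.2
  simp only [delta1]
  linarith

lemma continuousOn_delta1 (a b : ℝ) : ContinuousOn (delta1 a b) (Set.Iio 0) := by
  unfold delta1 phi
  refine ContinuousOn.add (by fun_prop) (ContinuousOn.sqrt ?_)
  refine ContinuousOn.div (by fun_prop) (by fun_prop) ?_
  intro s hs
  exact pow_ne_zero 2 (ne_of_lt hs)

lemma delta1_neg_b (a : ℝ) (b : ℝ) : delta1 a b (-b) = -2 * b := by
  simp [delta1, phi]

/-- `δ₁` is unbounded near `0`: for `-b / 2 ≤ s < 0` one has `φ(s) ≥ (3 / 4) b² / |s|`. -/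
lemma exists_le_delta1 {a b : ℝ} (hb : 0 < b) (hab : b < a) (h : ℝ) :
    ∃ s ∈ Set.Ico (-b) 0, h ≤ delta1 a b s := by
  set c := |h| + b with hc
  have hc0 : 0 < c := by positivity
  set m := min (b / 2) (3 / 4 * b ^ 2 / c) with hm
  have hm0 : 0 < m := by positivity
  have hm1 : m ≤ b / 2 := min_le_left _ _
  have hm2 : m * c ≤ 3 / 4 * b ^ 2 := by
    have : m ≤ 3 / 4 * b ^ 2 / c := min_le_right _ _
    rwa [le_div_iff₀ hc0] at this
  refine ⟨-m, ⟨by linarith, by linarith⟩, ?_⟩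
  have hphi : c ≤ phi a b (-m) := by
    refine Real.le_sqrt_of_sq_le ?_
    have h0 : 0 < (-m) ^ 2 := by rw [neg_sq]; positivity
    rw [le_div_iff₀ h0]
    have h1 : (m * c) ^ 2 ≤ (3 / 4 * b ^ 2) ^ 2 := by gcongr
    have h2 : m ^ 2 ≤ b ^ 2 / 4 := by nlinarith
    have h3 : 3 / 4 * b ^ 2 ≤ b ^ 2 - m ^ 2 := by linarith
    have h4 : 3 / 4 * b ^ 2 ≤ a ^ 2 - m ^ 2 := by nlinarith
    have h5 : (3 / 4 * b ^ 2) * (3 / 4 * b ^ 2) ≤ (a ^ 2 - m ^ 2) * (b ^ 2 - m ^ 2) := by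
      gcongr
      linarith [sq_nonneg b]
    nlinarith
  have := le_abs_self h
  simp only [delta1]
  linarith

lemma bijOn_delta1 {a b : ℝ} (hb : 0 < b) (hab : b < a) :
    Set.BijOn (delta1 a b) (Set.Ico (-b) 0) (Set.Ici (-2 * b)) := by
  refine ⟨?_, (strictMonoOn_delta1 hab).injOn, ?_⟩
  · intro s hs
    rw [Set.mem_Ici, ← delta1_neg_b a b]
    exact (strictMonoOn_delta1 hab).monotoneOn ⟨le_refl _, by linarith⟩ hs hs.1
  · intro h hh
    obtain ⟨t, ht, hht⟩ := exists_le_delta1 hb hab h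
    have hcont : ContinuousOn (delta1 a b) (Set.Icc (-b) t) :=
      (continuousOn_delta1 a b).mono fun x hx => lt_of_le_of_lt hx.2 ht.2
    have hmem : h ∈ Set.Icc (delta1 a b (-b)) (delta1 a b t) := by
      rw [delta1_neg_b]; exact ⟨hh, hht⟩
    obtain ⟨s, hs, rfl⟩ := intermediate_value_Icc ht.1 hcont hmem
    exact ⟨s, ⟨hs.1, lt_of_le_of_lt hs.2 ht.2⟩, rfl⟩

lemma s1_delta1 {a b s : ℝ} (hab : b < a) (hs : s ∈ Set.Ico (-b) 0) :
    s1 a b (delta1 a b s) = s :=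
  (strictMonoOn_delta1 hab).injOn.leftInvOn_invFunOn hs

/-- The value `g₁` in the form that matches `G = p² H / 2 - F² / 4`. -/
lemma g1_delta1_eq {a b s : ℝ} (hab : b < a) (hs : s ∈ Set.Ico (-b) 0) :
    g1 a b (delta1 a b s) = (a ^ 2 + b ^ 2) * delta1 a b s / 2
      - phi a b s * (√(a ^ 2 - s ^ 2) + √(b ^ 2 - s ^ 2)) ^ 2 / 2 := by
  rw [g1, s1_delta1 hab hs, delta1, phi_eq hab hs]
  obtain ⟨h1, h2⟩ := hs
  have hA : √(a ^ 2 - s ^ 2) ^ 2 = a ^ 2 - s ^ 2 := Real.sq_sqrt (by nlinarith)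
  have hB : √(b ^ 2 - s ^ 2) ^ 2 = b ^ 2 - s ^ 2 := Real.sq_sqrt (by nlinarith)
  generalize √(a ^ 2 - s ^ 2) = A at *
  generalize √(b ^ 2 - s ^ 2) = B at *
  have h3 : s ≠ 0 := h2.ne
  have hA' : a ^ 2 = A ^ 2 + s ^ 2 := by linarith
  have hB' : b ^ 2 = B ^ 2 + s ^ 2 := by linarith
  rw [mul_pow, hA', hB']
  field_simp
  ring

/-! ### The set `K = 0` and the partial integral `F` -/

/-- The function `F = (ω₁² + ω₂²) ω₃ + 2 (α₃ ω₁ + β₃ ω₂)`. On the set `K = 0` it carries the same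
information as `G`, up to sign, once `H` is known. -/
def partialF (ζ : Config) : ℝ :=
  (ζ.1 0 ^ 2 + ζ.1 1 ^ 2) * ζ.1 2 + 2 * (ζ.2.1 2 * ζ.1 0 + ζ.2.2 2 * ζ.1 1)

lemma mem_phaseSpace {a b : ℝ} {ζ : Config} : ζ ∈ phaseSpace a b ↔
    ζ.2.1 0 ^ 2 + ζ.2.1 1 ^ 2 + ζ.2.1 2 ^ 2 = a ^ 2 ∧
    ζ.2.2 0 ^ 2 + ζ.2.2 1 ^ 2 + ζ.2.2 2 ^ 2 = b ^ 2 ∧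
    ζ.2.1 0 * ζ.2.2 0 + ζ.2.1 1 * ζ.2.2 1 + ζ.2.1 2 * ζ.2.2 2 = 0 := by
  simp [phaseSpace, geom]

lemma intK_eq_zero {ζ : Config} : intK ζ = 0 ↔
    ζ.1 0 ^ 2 - ζ.1 1 ^ 2 + ζ.2.1 0 - ζ.2.2 1 = 0 ∧
    2 * ζ.1 0 * ζ.1 1 + ζ.2.1 1 + ζ.2.2 0 = 0 := by
  rw [intK, add_eq_zero_iff_of_nonneg (sq_nonneg _) (sq_nonneg _), sq_eq_zero_iff, sq_eq_zero_iff]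

lemma intG_eq_of_intK_eq_zero {a b : ℝ} {ζ : Config} (hζ : ζ ∈ phaseSpace a b)
    (hK : intK ζ = 0) :
    intG a b ζ = (a ^ 2 + b ^ 2) * intH ζ / 2 - partialF ζ ^ 2 / 4 := by
  obtain ⟨hA, hB, hd⟩ := mem_phaseSpace.1 hζ
  obtain ⟨h1, h2⟩ := intK_eq_zero.1 hK
  have e1 : ζ.2.2 1 = ζ.1 0 ^ 2 - ζ.1 1 ^ 2 + ζ.2.1 0 := by linarith
  have e2 : ζ.2.2 0 = -2 * ζ.1 0 * ζ.1 1 - ζ.2.1 1 := by linarith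
  simp only [intG, intH, partialF, gam, cross_apply, Matrix.cons_val]
  rw [← hA, ← hB]
  rw [e1, e2] at hd ⊢
  linear_combination 2 * ζ.1 0 * ζ.1 1 * hd

/-! ### Criticality of the points with `K = 0` -/

lemma differentiable_J (a b : ℝ) : Differentiable ℝ (J a b) := by
  unfold J intH intK intG gam
  simp only [cross_apply, Matrix.cons_val]
  fun_prop

/-- `K ≥ 0`, so the differential of `K` vanishes where `K` does, and the differential of `J` is not
onto. -/
lemma rankJ_lt_three {a b : ℝ} {ζ : Config} (hK : intK ζ = 0) : rankJ a b ζ < 3 := by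
  have hmin : IsLocalMin intK ζ := by
    refine Filter.Eventually.of_forall fun x => ?_
    rw [hK]
    exact add_nonneg (sq_nonneg _) (sq_nonneg _)
  have hfd : HasFDerivAt intK
      (((ContinuousLinearMap.fst ℝ ℝ ℝ).comp (ContinuousLinearMap.snd ℝ ℝ (ℝ × ℝ))).comp
        (fderiv ℝ (J a b) ζ)) ζ :=
    HasFDerivAt.comp ζ (((ContinuousLinearMap.fst ℝ ℝ ℝ).comp
        (ContinuousLinearMap.snd ℝ ℝ (ℝ × ℝ))).hasFDerivAt (x := J a b ζ))
      (differentiable_J a b ζ).hasFDerivAt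
  have hzero := hmin.hasFDerivAt_eq_zero hfd
  have hlt : (tangent ζ).map (fderiv ℝ (J a b) ζ : Config →ₗ[ℝ] ℝ × ℝ × ℝ) < ⊤ := by
    rw [lt_top_iff_ne_top]
    intro htop
    have hmem : ((0, 1, 0) : ℝ × ℝ × ℝ) ∈
        (tangent ζ).map (fderiv ℝ (J a b) ζ : Config →ₗ[ℝ] ℝ × ℝ × ℝ) := by
      rw [htop]; trivial
    obtain ⟨v, -, hv⟩ := hmem
    have h1 : (fderiv ℝ (J a b) ζ v).2.1 = 0 := DFunLike.congr_fun hzero v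
    have h2 : fderiv ℝ (J a b) ζ v = (0, 1, 0) := hv
    rw [h2] at h1
    exact one_ne_zero h1
  have := Submodule.finrank_lt hlt.ne
  simpa [rankJ] using this

/-! ### The greatest value of `F` on a level of `H` -/

/-- The sum-of-squares certificate for the lower bound of `H - θ F` on `K = 0`. The last two
brackets are quadratic forms in `(ω₁, α₃)` and `(ω₂, β₃)`; by the choice of `θ` both are degenerate
and nonnegative. -/
lemma intH_sub_partialF_eq {a b σ A B θ : ℝ} {ζ : Config} (hσ : 0 < σ) (hApos : 0 < A)
    (hBnn : 0 ≤ B) (hA : A ^ 2 = a ^ 2 - σ ^ 2) (hB : B ^ 2 = b ^ 2 - σ ^ 2)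
    (hθ : θ ^ 2 = 2 * A * B / (σ * (A + B) ^ 2))
    (hζ : ζ ∈ phaseSpace a b) (hK : intK ζ = 0) :
    intH ζ + (2 * σ + A * B / σ) - θ * partialF ζ =
      (ζ.1 2 - θ * (ζ.1 0 ^ 2 + ζ.1 1 ^ 2)) ^ 2 / 2
      + 1 / (4 * σ) *
        ((ζ.2.1 0 + ζ.2.2 1 - (B - A) / (A + B) * (ζ.1 0 ^ 2 - ζ.1 1 ^ 2) - 2 * σ) ^ 2
          + (ζ.2.1 1 - ζ.2.2 0 - 2 * ((B - A) / (A + B)) * ζ.1 0 * ζ.1 1) ^ 2)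
      + (2 * A / (A + B) * ζ.1 0 ^ 2 + B / (σ * (A + B)) * ζ.2.1 2 ^ 2
          - 2 * θ * (ζ.1 0 * ζ.2.1 2))
      + (2 * B / (A + B) * ζ.1 1 ^ 2 + A / (σ * (A + B)) * ζ.2.2 2 ^ 2
          - 2 * θ * (ζ.1 1 * ζ.2.2 2)) := by
  obtain ⟨hα, hβ, -⟩ := mem_phaseSpace.1 hζ
  obtain ⟨h1, h2⟩ := intK_eq_zero.1 hK
  have hq : 0 < A + B := by linarith
  have e1 : ζ.2.2 1 = ζ.1 0 ^ 2 - ζ.1 1 ^ 2 + ζ.2.1 0 := by linarith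
  have e2 : ζ.2.2 0 = -2 * ζ.1 0 * ζ.1 1 - ζ.2.1 1 := by linarith
  rw [e1, e2] at hβ
  simp only [intH, partialF]
  rw [e1, e2]
  generalize ζ.1 0 = w1 at *
  generalize ζ.1 1 = w2 at *
  generalize ζ.1 2 = w3 at *
  generalize ζ.2.1 0 = a1 at *
  generalize ζ.2.1 1 = a2 at *
  generalize ζ.2.1 2 = a3 at *
  generalize ζ.2.2 2 = b3 at *
  have e3 : a3 ^ 2 = A ^ 2 + σ ^ 2 - a1 ^ 2 - a2 ^ 2 := by linarith
  have e4 : b3 ^ 2 = B ^ 2 + σ ^ 2 - (-2 * w1 * w2 - a2) ^ 2 - (w1 ^ 2 - w2 ^ 2 + a1) ^ 2 := by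
    linarith
  have e5 : (w3 - θ * (w1 ^ 2 + w2 ^ 2)) ^ 2
      = w3 ^ 2 - 2 * θ * w3 * (w1 ^ 2 + w2 ^ 2) + θ ^ 2 * (w1 ^ 2 + w2 ^ 2) ^ 2 := by ring
  rw [e5, e3, e4, hθ]
  field_simp
  ring

lemma two_mul_mul_le_of_sq_eq_mul {p q θ : ℝ} (hp : 0 ≤ p) (hq : 0 ≤ q) (hθ : θ ^ 2 = p * q)
    (x y : ℝ) : 2 * θ * (x * y) ≤ p * x ^ 2 + q * y ^ 2 := by
  refine le_of_abs_le (abs_le_of_sq_le_sq ?_ (by positivity))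
  have : (2 * θ * (x * y)) ^ 2 = 4 * (p * q) * (x * y) ^ 2 := by rw [← hθ]; ring
  rw [this]
  nlinarith [sq_nonneg (p * x ^ 2 - q * y ^ 2)]

lemma mul_partialF_le {a b σ A B θ : ℝ} {ζ : Config} (hσ : 0 < σ) (hApos : 0 < A)
    (hBnn : 0 ≤ B) (hA : A ^ 2 = a ^ 2 - σ ^ 2) (hB : B ^ 2 = b ^ 2 - σ ^ 2)
    (hθ : θ ^ 2 = 2 * A * B / (σ * (A + B) ^ 2))
    (hζ : ζ ∈ phaseSpace a b) (hK : intK ζ = 0) :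
    θ * partialF ζ ≤ intH ζ + (2 * σ + A * B / σ) := by
  have key := intH_sub_partialF_eq hσ hApos hBnn hA hB hθ hζ hK
  have h1 := two_mul_mul_le_of_sq_eq_mul (p := 2 * A / (A + B)) (q := B / (σ * (A + B)))
    (θ := θ) (by positivity) (by positivity) (by rw [hθ]; field_simp) (ζ.1 0) (ζ.2.1 2)
  have h2 := two_mul_mul_le_of_sq_eq_mul (p := 2 * B / (A + B)) (q := A / (σ * (A + B)))
    (θ := θ) (by positivity) (by positivity) (by rw [hθ]; field_simp) (ζ.1 1) (ζ.2.2 2)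
  have h3 : 0 ≤ 1 / (4 * σ) *
      ((ζ.2.1 0 + ζ.2.2 1 - (B - A) / (A + B) * (ζ.1 0 ^ 2 - ζ.1 1 ^ 2) - 2 * σ) ^ 2
        + (ζ.2.1 1 - ζ.2.2 0 - 2 * ((B - A) / (A + B)) * ζ.1 0 * ζ.1 1) ^ 2) := by positivity
  linarith [sq_nonneg (ζ.1 2 - θ * (ζ.1 0 ^ 2 + ζ.1 1 ^ 2))]

/-- The certificate at `σ = b`, where `B = θ = 0`. -/
lemma neg_two_mul_le_intH {a b : ℝ} {ζ : Config} (hb : 0 < b) (hab : b < a)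
    (hζ : ζ ∈ phaseSpace a b) (hK : intK ζ = 0) : -2 * b ≤ intH ζ := by
  have hpos : 0 < a ^ 2 - b ^ 2 := by nlinarith
  have h := mul_partialF_le (θ := 0) hb (Real.sqrt_pos.2 hpos) le_rfl (Real.sq_sqrt hpos.le)
    (by ring) (by simp) hζ hK
  simp only [zero_mul, mul_zero, zero_div, add_zero] at h
  linarith

lemma partialF_eq_zero {a b : ℝ} {ζ : Config} (hb : 0 < b) (hab : b < a)
    (hζ : ζ ∈ phaseSpace a b) (hK : intK ζ = 0) (hH : intH ζ = -2 * b) : partialF ζ = 0 := by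
  have hpos : 0 < a ^ 2 - b ^ 2 := by nlinarith
  have hA := Real.sqrt_pos.2 hpos
  have key := intH_sub_partialF_eq (θ := 0) hb hA le_rfl (Real.sq_sqrt hpos.le)
    (by ring) (by simp) hζ hK
  rw [hH] at key
  generalize √(a ^ 2 - b ^ 2) = A at *
  have h0 : 2 * A / (A + 0) = 2 := by field_simp; ring
  have h1 : A / (b * (A + 0)) = 1 / b := by field_simp; ring
  rw [h0, h1] at key
  have h2 : 0 ≤ 1 / (4 * b) *
      ((ζ.2.1 0 + ζ.2.2 1 - (0 - A) / (A + 0) * (ζ.1 0 ^ 2 - ζ.1 1 ^ 2) - 2 * b) ^ 2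
        + (ζ.2.1 1 - ζ.2.2 0 - 2 * ((0 - A) / (A + 0)) * ζ.1 0 * ζ.1 1) ^ 2) := by positivity
  have h3 : 0 ≤ 1 / b * ζ.2.2 2 ^ 2 := by positivity
  simp only [zero_mul, mul_zero, zero_div, add_zero, sub_zero, zero_add] at key h2
  have hw3 : ζ.1 2 = 0 := by
    refine pow_eq_zero_iff two_ne_zero |>.1 (le_antisymm ?_ (sq_nonneg _))
    linarith [sq_nonneg (ζ.1 0)]
  have hw1 : ζ.1 0 = 0 := by
    refine pow_eq_zero_iff two_ne_zero |>.1 (le_antisymm ?_ (sq_nonneg _))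
    linarith [sq_nonneg (ζ.1 2)]
  have hb3 : ζ.2.2 2 = 0 := by
    have : 1 / b * ζ.2.2 2 ^ 2 = 0 := by
      refine le_antisymm ?_ h3
      linarith [sq_nonneg (ζ.1 2), sq_nonneg (ζ.1 0)]
    simpa [hb.ne'] using this
  simp [partialF, hw1, hw3, hb3]

lemma partialF_sq_le {a b σ A B : ℝ} {ζ : Config} (hσ : 0 < σ) (hσb : σ ≤ b) (hab : b < a)
    (hApos : 0 < A) (hBnn : 0 ≤ B) (hA : A ^ 2 = a ^ 2 - σ ^ 2) (hB : B ^ 2 = b ^ 2 - σ ^ 2)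
    (hζ : ζ ∈ phaseSpace a b) (hK : intK ζ = 0) (hH : intH ζ = -2 * σ + A * B / σ) :
    partialF ζ ^ 2 ≤ 2 * (A * B / σ) * (A + B) ^ 2 := by
  rcases hBnn.eq_or_lt with rfl | hBpos
  · have hσb' : σ = b := by nlinarith
    subst hσb'
    have := partialF_eq_zero hσ hab hζ hK (by simpa using hH)
    simp [this]
  · set θ := √(2 * A * B / (σ * (A + B) ^ 2)) with hθdef
    have hθ : θ ^ 2 = 2 * A * B / (σ * (A + B) ^ 2) := Real.sq_sqrt (by positivity)
    have h1 := mul_partialF_le hσ hApos hBnn hA hB hθ hζ hK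
    have h2 := mul_partialF_le (θ := -θ) hσ hApos hBnn hA hB (by rw [neg_sq, hθ]) hζ hK
    rw [hH] at h1 h2
    have h3 : (θ * partialF ζ) ^ 2 ≤ (2 * (A * B / σ)) ^ 2 :=
      sq_le_sq' (by linarith) (by linarith)
    rw [mul_pow, hθ] at h3
    have h4 : 2 * A * B / (σ * (A + B) ^ 2) * (2 * (A * B / σ) * (A + B) ^ 2)
        = (2 * (A * B / σ)) ^ 2 := by field_simp
    rw [← h4] at h3
    exact le_of_mul_le_mul_left h3 (by positivity)

/-! ### A curve on which `F` takes all its values -/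

/-- The points with `ω₁² = u`, `ω₂ = 0`, `α = (b - u, 0, α₃)`, `β = (0, b, 0)` on the level
`H = h`. -/
lemma exists_partialF_eq {a b h u : ℝ} (hu : 0 ≤ u) (hu1 : 2 * u ≤ h + 2 * b)
    (hu2 : (b - u) ^ 2 ≤ a ^ 2) :
    ∃ ζ ∈ phaseSpace a b, intK ζ = 0 ∧ intH ζ = h ∧
      partialF ζ = u * √(2 * (h + 2 * b - 2 * u)) + 2 * √(u * (a ^ 2 - (b - u) ^ 2)) := by
  have s1 : √u ^ 2 = u := Real.sq_sqrt hu
  have s2 : √(2 * (h + 2 * b - 2 * u)) ^ 2 = 2 * (h + 2 * b - 2 * u) :=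
    Real.sq_sqrt (by linarith)
  have s3 : √(a ^ 2 - (b - u) ^ 2) ^ 2 = a ^ 2 - (b - u) ^ 2 := Real.sq_sqrt (by linarith)
  refine ⟨(![√u, 0, √(2 * (h + 2 * b - 2 * u))], ![b - u, 0, √(a ^ 2 - (b - u) ^ 2)],
    ![0, b, 0]), mem_phaseSpace.2 ⟨?_, ?_, ?_⟩, intK_eq_zero.2 ⟨?_, ?_⟩, ?_, ?_⟩
  · simp only [Matrix.cons_val]; linarith
  · simp
  · simp
  · simp only [Matrix.cons_val]; linarith
  · simp
  · simp only [intH, Matrix.cons_val]; linarith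
  · simp only [partialF, Matrix.cons_val]
    rw [Real.sqrt_mul hu, s1]
    ring

/-- All values between `0` and the upper bound of `partialF_sq_le` are attained. -/
lemma exists_partialF_eq_of_le {a b σ A B f : ℝ} (hσ : 0 < σ) (hσb : σ ≤ b) (hab : b < a)
    (hApos : 0 < A) (hBnn : 0 ≤ B) (hA : A ^ 2 = a ^ 2 - σ ^ 2) (hB : B ^ 2 = b ^ 2 - σ ^ 2)
    (hf : 0 ≤ f) (hf1 : f ≤ √(2 * (A * B / σ)) * (A + B)) :
    ∃ ζ ∈ phaseSpace a b, intK ζ = 0 ∧ intH ζ = -2 * σ + A * B / σ ∧ partialF ζ = f := by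
  set h := -2 * σ + A * B / σ with hh
  -- `t = √((b - σ) / (b + σ))`, and the maximum of `F` is at `u = (A + B) t`.
  set t := B / (b + σ) with ht
  have hbσ : 0 < b + σ := by linarith
  have ht0 : 0 ≤ t := by positivity
  have hBt : B = t * (b + σ) := by rw [ht]; field_simp
  have ht2 : t * B = b - σ := by
    rw [ht, div_mul_eq_mul_div, ← sq, hB]; field_simp; ring
  have htt : t ^ 2 + 2 * (σ / (b + σ)) = 1 := by
    have : t ^ 2 = (b - σ) / (b + σ) := by
      rw [eq_div_iff hbσ.ne', ← ht2]; linear_combination (-t) * hBt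
    rw [this]; field_simp; ring
  set U := (A + B) * t with hU
  have hU0 : 0 ≤ U := by positivity
  set R := √(2 * (A * B / σ)) with hR
  have hR0 : 0 ≤ R := Real.sqrt_nonneg _
  have hR2 : R ^ 2 = 2 * (A * B / σ) := Real.sq_sqrt (by positivity)
  have hX : 2 * (h + 2 * b - 2 * U) = (R * t) ^ 2 := by
    have e : A * B * t ^ 2 = A * B - 2 * A * t * σ := by
      have : A * B * t ^ 2 = A * t * (t * B) := by ring
      rw [this, ht2]
      linear_combination -A * hBt
    rw [mul_pow, hR2, hh, hU]
    have e2 : 2 * (A * B / σ) * t ^ 2 = 2 * (A * B - 2 * A * t * σ) / σ := by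
      rw [← e]; ring
    rw [e2]
    field_simp
    linear_combination (-2) * σ * ht2
  have hY : a ^ 2 - (b - U) ^ 2 = 2 * σ * A * (A + B) / (b + σ) := by
    have e : b - U = σ - A * t := by rw [hU]; linear_combination (-1) * ht2
    have e2 : a ^ 2 = A ^ 2 + σ ^ 2 := by linarith
    have e3 : t ^ 2 = 1 - 2 * (σ / (b + σ)) := by linarith
    have e4 : a ^ 2 - (b - U) ^ 2 = A ^ 2 * (1 - t ^ 2) + 2 * A * σ * t := by
      rw [e, e2]; ring
    rw [e4, e3, ht]
    field_simp
    ring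
  have hUY : U * (a ^ 2 - (b - U) ^ 2) = (R * (A + B) * (σ / (b + σ))) ^ 2 := by
    rw [hY, mul_pow, mul_pow, hR2, hU, ht]
    field_simp
  have hFU : U * √(2 * (h + 2 * b - 2 * U)) + 2 * √(U * (a ^ 2 - (b - U) ^ 2))
      = R * (A + B) := by
    rw [hX, hUY, Real.sqrt_sq (by positivity), Real.sqrt_sq (by positivity)]
    linear_combination R * (A + B) * htt
  have hU1 : 2 * U ≤ h + 2 * b := by linarith [sq_nonneg (R * t)]
  have hU2 : (b - U) ^ 2 ≤ a ^ 2 := by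
    have : 0 ≤ 2 * σ * A * (A + B) / (b + σ) := by positivity
    linarith
  have hcont : ContinuousOn
      (fun u => u * √(2 * (h + 2 * b - 2 * u)) + 2 * √(u * (a ^ 2 - (b - u) ^ 2)))
      (Set.Icc 0 U) := by fun_prop
  obtain ⟨u, ⟨hu0, huU⟩, hu⟩ := intermediate_value_Icc hU0 hcont
    (show f ∈ Set.Icc _ _ from ⟨by simpa using hf, by simpa only [hFU] using hf1⟩)
  have hu2 : (b - u) ^ 2 ≤ a ^ 2 := by
    have := abs_le_of_sq_le_sq' hU2 (by linarith)
    exact sq_le_sq' (by linarith) (by linarith)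
  obtain ⟨ζ, hζ, hK, hH, hF⟩ := exists_partialF_eq hu0 (by linarith : 2 * u ≤ h + 2 * b) hu2
  exact ⟨ζ, hζ, hK, hH, hF.trans hu⟩

/-! ### The image of the set `K = 0` -/

lemma mem_sigma1_inter_bifDiagram {a b : ℝ} {x : ℝ × ℝ × ℝ} :
    x ∈ sigma1 ∩ bifDiagram a b ↔ ∃ ζ ∈ phaseSpace a b, intK ζ = 0 ∧ J a b ζ = x := by
  constructor
  · rintro ⟨hx, ζ, ⟨hζ, -⟩, rfl⟩
    exact ⟨ζ, hζ, hx, rfl⟩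
  · rintro ⟨ζ, hζ, hK, rfl⟩
    exact ⟨hK, ζ, ⟨hζ, rankJ_lt_three hK⟩, rfl⟩

/-- On the level `H = δ₁(s)` of the set `K = 0` the range of `G` is `[g₁, p² h / 2]`. -/
lemma exists_intG_eq_iff {a b s g : ℝ} (hab : b < a) (hs : s ∈ Set.Ico (-b) 0) :
    (∃ ζ ∈ phaseSpace a b, intK ζ = 0 ∧ intH ζ = delta1 a b s ∧ intG a b ζ = g) ↔
      g1 a b (delta1 a b s) ≤ g ∧ g ≤ p a b ^ 2 * delta1 a b s / 2 := by
  have hp : p a b ^ 2 = a ^ 2 + b ^ 2 := Real.sq_sqrt (by positivity)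
  rw [g1_delta1_eq hab hs, hp, delta1, phi_eq hab hs]
  have hσ : 0 < -s := by linarith [hs.2]
  have hσb : -s ≤ b := by linarith [hs.1]
  have hApos : 0 < √(a ^ 2 - s ^ 2) := Real.sqrt_pos.2 (by nlinarith)
  have hBnn : 0 ≤ √(b ^ 2 - s ^ 2) := Real.sqrt_nonneg _
  have hA : √(a ^ 2 - s ^ 2) ^ 2 = a ^ 2 - (-s) ^ 2 := by
    rw [neg_sq]; exact Real.sq_sqrt (by nlinarith)
  have hB : √(b ^ 2 - s ^ 2) ^ 2 = b ^ 2 - (-s) ^ 2 := by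
    rw [neg_sq]; exact Real.sq_sqrt (by nlinarith)
  generalize √(a ^ 2 - s ^ 2) = A at *
  generalize √(b ^ 2 - s ^ 2) = B at *
  have hneg : 2 * s = -2 * -s := by ring
  rw [hneg]
  generalize -s = σ at *
  constructor
  · rintro ⟨ζ, hζ, hK, hH, rfl⟩
    have hF := partialF_sq_le hσ hσb hab hApos hBnn hA hB hζ hK hH
    rw [intG_eq_of_intK_eq_zero hζ hK, hH]
    exact ⟨by linarith, by linarith [sq_nonneg (partialF ζ)]⟩
  · rintro ⟨h1, h2⟩
    set d := 4 * ((a ^ 2 + b ^ 2) * (-2 * σ + A * B / σ) / 2 - g) with hd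
    have hd0 : 0 ≤ d := by linarith
    have hle : √d ≤ √(2 * (A * B / σ)) * (A + B) := by
      refine Real.sqrt_le_iff.2 ⟨by positivity, ?_⟩
      rw [mul_pow, Real.sq_sqrt (by positivity)]
      linarith
    obtain ⟨ζ, hζ, hK, hH, hF⟩ :=
      exists_partialF_eq_of_le hσ hσb hab hApos hBnn hA hB (Real.sqrt_nonneg d) hle
    refine ⟨ζ, hζ, hK, hH, ?_⟩
    rw [intG_eq_of_intK_eq_zero hζ hK, hH, hF, Real.sq_sqrt hd0, hd]
    ring

end KowalevskiTop

theorem theorem5 (a b : ℝ) (hb : 0 < b) (hab : b < a) :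
    StrictMonoOn (KowalevskiTop.delta1 a b) (Set.Ico (-b) 0) ∧
    Set.BijOn (KowalevskiTop.delta1 a b) (Set.Ico (-b) 0) (Set.Ici (-2 * b)) ∧
    KowalevskiTop.sigma1 ∩ KowalevskiTop.bifDiagram a b =
      {x : ℝ × ℝ × ℝ | ∃ h k g : ℝ, x = (h, k, g) ∧ k = 0 ∧ -2 * b ≤ h ∧
        KowalevskiTop.g1 a b h ≤ g ∧ g ≤ KowalevskiTop.p a b ^ 2 * h / 2} := by
  have hbij := KowalevskiTop.bijOn_delta1 hb hab
  refine ⟨KowalevskiTop.strictMonoOn_delta1 hab, hbij, ?_⟩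
  ext x
  rw [KowalevskiTop.mem_sigma1_inter_bifDiagram]
  constructor
  · rintro ⟨ζ, hζ, hK, rfl⟩
    have hH := KowalevskiTop.neg_two_mul_le_intH hb hab hζ hK
    obtain ⟨s, hs, hsH⟩ := hbij.surjOn hH
    have hG := (KowalevskiTop.exists_intG_eq_iff hab hs).1 ⟨ζ, hζ, hK, hsH.symm, rfl⟩
    rw [hsH] at hG
    exact ⟨_, _, _, rfl, hK, hH, hG⟩
  · rintro ⟨h, k, g, rfl, rfl, hh, hg⟩
    obtain ⟨s, hs, rfl⟩ := hbij.surjOn hh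
    obtain ⟨ζ, hζ, hK, hH, hG⟩ := (KowalevskiTop.exists_intG_eq_iff hab hs).2 hg
    exact ⟨ζ, hζ, hK, by rw [KowalevskiTop.J, hK, hH, hG]⟩
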